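/- Let $\Theta\subset\mathbb{R}^n$ be a nonempty, compact, convex parameter set, let $\mu$ be a Borel measure on $\mathbb{R}^d$ (e.g. Lebesgue measure or a counting measure), and for $\theta\in\Theta$ let $p(\cdot\,|\,\theta)\ge 0$ be the density with respect to $\mu$ of a probability measure $\mathbb{P}_\theta$ on $\mathbb{R}^d$. Let $p(\theta)$ be a prior probability density on $\Theta$ with respect to Lebesgue measure, and let $\theta^c\in\Theta$ be the true parameter. Assume: (i) there is a function $h$, integrable with respect to $\mathbb{P}_{\theta^c}$, such that for $\mathbb{P}_{\theta^c}$-almost every $\xi$ one has $p(\xi|\theta)>0$ and $|\ln p(\xi|\theta)|\le h(\xi)$ for all $\theta\in\Theta$; moreover, for $\mathbb{P}_{\theta^c}$-almost every $\xi$ the map $\theta\mapsto p(\xi|\theta)$ is continuous on $\Theta$; (ii) there are constants $c_1>c_2>0$ with $c_1\ge p(\theta)\ge c_2$ for all $\theta\in\Theta$. Let $\xi^1,\xi^2,\dots$ be i.i.d. with law $\mathbb{P}_{\theta^c}$, let $\mathcal{S}^N=\{\xi^1,\dots,\xi^N\}$, and let $\mathbb{P}_{\mathcal{S}^N}$ be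 the posterior distribution, i.e. the distribution of a random vector $\tilde\theta$ with density $$p(\theta|\mathcal{S}^N)=\frac{\prod_{i=1}^N p(\xi^i|\theta)\,p(\theta)}{\int_\Theta \prod_{i=1}^N p(\xi^i|\theta')\,p(\theta')\,d\theta'}\qquad(\theta\in\Theta).$$ Let $0\le\alpha<1$ and let $\Theta(\mathcal{S}^N,\alpha)\subset\Theta$ be credible sets of level $1-\alpha$: each is determined by the sample $\mathcal{S}^N$ and, almost surely, for every $N$ it is a Borel set with $\mathbb{P}_{\mathcal{S}^N}(\tilde\theta\in\Theta(\mathcal{S}^N,\alpha))\ge 1-\alpha$. Put $\phi(\theta)=\mathbb{E}_{\mathbb{P}_{\theta^c}}[\ln p(\xi|\theta)]$ and, for $\omega>0$, $U_\omega=\{\theta\in\Theta:\phi(\theta^c)-\phi(\theta)<\omega\}$. Then for every $\omega>0$, with probability one with respect to the sequence $\xi^1,\xi^2,\dots$, $$\mathbb{P}_{\mathcal{S}^N}\big(\tilde\theta\in U_\omega\;\big|\;\tilde\theta\in\Theta(\mathcal{S}^N,\alpha)\big)\to 1\qquad(N\to\infty).$$ The convergence is exponentially fast: for all $0<b<a<\omega$,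 the volume $\kappa(b)=\int_{U_b}d\theta$ is positive and, with $\nu=\int_\Theta d\theta$, with probability one, for all sufficiently large $N$ (depending on the realization), $$\mathbb{P}_{\mathcal{S}^N}\big(\tilde\theta\in U_\omega\;\big|\;\tilde\theta\in\Theta(\mathcal{S}^N,\alpha)\big)\;\ge\;1-\frac{\kappa(b)^{-1}\,\nu\,e^{-N(a-b)}}{1-\alpha}.$$ -/

import Mathlib

open MeasureTheory ProbabilityTheory Filter Topology

noncomputable section

namespace BayesCredible

/-- `p ξ θ` is the density `p(ξ|θ)`, with respect to the reference measure `μ` on the sample space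
(Lebesgue measure for continuous laws, a counting measure for discrete ones), of a probability
measure `P_θ`, for every parameter `θ ∈ Θ`. -/
structure IsDensityFamily {d n : ℕ} (μ : Measure (EuclideanSpace ℝ (Fin d)))
    (Θ : Set (EuclideanSpace ℝ (Fin n)))
    (p : EuclideanSpace ℝ (Fin d) → EuclideanSpace ℝ (Fin n) → ℝ) : Prop where
  measurable : ∀ θ ∈ Θ, Measurable fun ξ => p ξ θ
  nonneg : ∀ θ ∈ Θ, ∀ ξ, 0 ≤ p ξ θ
  lintegral_eq_one : ∀ θ ∈ Θ, ∫⁻ ξ, ENNReal.ofReal (p ξ θ) ∂μ = 1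

/-- The sampling distribution `P_θ`, with density `p(·|θ)` with respect to `μ`. -/
def samplingLaw {d n : ℕ} (μ : Measure (EuclideanSpace ℝ (Fin d)))
    (p : EuclideanSpace ℝ (Fin d) → EuclideanSpace ℝ (Fin n) → ℝ)
    (θ : EuclideanSpace ℝ (Fin n)) : Measure (EuclideanSpace ℝ (Fin d)) :=
  μ.withDensity fun ξ => ENNReal.ofReal (p ξ θ)

/-- `q` is a probability density on the parameter set `Θ` with respect to Lebesgue measure. -/
structure IsPriorDensity {n : ℕ} (Θ : Set (EuclideanSpace ℝ (Fin n)))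
    (q : EuclideanSpace ℝ (Fin n) → ℝ) : Prop where
  nonneg : ∀ θ ∈ Θ, 0 ≤ q θ
  integrableOn : IntegrableOn q Θ volume
  integral_eq_one : ∫ θ in Θ, q θ = 1

/-- The likelihood `p(S^N|θ) = ∏ᵢ p(ξⁱ|θ)` of a sample `x = (ξ¹, …, ξᴺ)`. -/
def likelihood {d n : ℕ} (p : EuclideanSpace ℝ (Fin d) → EuclideanSpace ℝ (Fin n) → ℝ)
    {N : ℕ} (x : Fin N → EuclideanSpace ℝ (Fin d)) (θ : EuclideanSpace ℝ (Fin n)) : ℝ :=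
  ∏ i, p (x i) θ

/-- The posterior density `p(θ|S^N)` given by Bayes' rule. -/
def posteriorDensity {d n : ℕ} (Θ : Set (EuclideanSpace ℝ (Fin n)))
    (p : EuclideanSpace ℝ (Fin d) → EuclideanSpace ℝ (Fin n) → ℝ)
    (q : EuclideanSpace ℝ (Fin n) → ℝ)
    {N : ℕ} (x : Fin N → EuclideanSpace ℝ (Fin d)) (θ : EuclideanSpace ℝ (Fin n)) : ℝ :=
  likelihood p x θ * q θ / ∫ θ' in Θ, likelihood p x θ' * q θ'

/-- The posterior distribution `P_{S^N}` on `Θ`. -/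
def posteriorLaw {d n : ℕ} (Θ : Set (EuclideanSpace ℝ (Fin n)))
    (p : EuclideanSpace ℝ (Fin d) → EuclideanSpace ℝ (Fin n) → ℝ)
    (q : EuclideanSpace ℝ (Fin n) → ℝ)
    {N : ℕ} (x : Fin N → EuclideanSpace ℝ (Fin d)) : Measure (EuclideanSpace ℝ (Fin n)) :=
  (volume.restrict Θ).withDensity fun θ => ENNReal.ofReal (posteriorDensity Θ p q x θ)

/-- `C` is a credible set of level `1 - α` for the distribution `ρ` on `Θ`. -/
structure IsCredibleSet {n : ℕ} (Θ : Set (EuclideanSpace ℝ (Fin n)))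
    (ρ : Measure (EuclideanSpace ℝ (Fin n))) (α : ℝ)
    (C : Set (EuclideanSpace ℝ (Fin n))) : Prop where
  subset : C ⊆ Θ
  measurableSet : MeasurableSet C
  coverage : ENNReal.ofReal (1 - α) ≤ ρ C

/-- The expected log-likelihood `φ(θ) = E_{P_θc} [ln p(ξ|θ)]`. -/
def expectedLogLik {d n : ℕ} (μ : Measure (EuclideanSpace ℝ (Fin d)))
    (p : EuclideanSpace ℝ (Fin d) → EuclideanSpace ℝ (Fin n) → ℝ)
    (θc θ : EuclideanSpace ℝ (Fin n)) : ℝ :=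
  ∫ ξ, Real.log (p ξ θ) ∂(samplingLaw μ p θc)

/-- The neighbourhood `U_ω = {θ ∈ Θ : φ(θc) - φ(θ) < ω}` of `θc`. -/
def nbhdU {d n : ℕ} (μ : Measure (EuclideanSpace ℝ (Fin d)))
    (Θ : Set (EuclideanSpace ℝ (Fin n)))
    (p : EuclideanSpace ℝ (Fin d) → EuclideanSpace ℝ (Fin n) → ℝ)
    (θc : EuclideanSpace ℝ (Fin n)) (ω : ℝ) : Set (EuclideanSpace ℝ (Fin n)) :=
  {θ ∈ Θ | expectedLogLik μ p θc θc - expectedLogLik μ p θc θ < ω}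

/-- The standing regularity assumption. Positivity of `p(ξ|θ)` is part of `|ln p(ξ|θ)| ≤ h(ξ) < ∞`
and has to be written out, because `Real.log 0 = 0`. -/
structure Regular {d n : ℕ} (μ : Measure (EuclideanSpace ℝ (Fin d)))
    (Θ : Set (EuclideanSpace ℝ (Fin n)))
    (p : EuclideanSpace ℝ (Fin d) → EuclideanSpace ℝ (Fin n) → ℝ)
    (q : EuclideanSpace ℝ (Fin n) → ℝ) (θc : EuclideanSpace ℝ (Fin n)) : Prop where
  dominated : ∃ h : EuclideanSpace ℝ (Fin d) → ℝ, Integrable h (samplingLaw μ p θc) ∧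
    ∀ᵐ ξ ∂(samplingLaw μ p θc), ∀ θ ∈ Θ, 0 < p ξ θ ∧ |Real.log (p ξ θ)| ≤ h ξ
  continuousOn : ∀ᵐ ξ ∂(samplingLaw μ p θc), ContinuousOn (fun θ => p ξ θ) Θ
  prior_bounds : ∃ c₁ c₂ : ℝ, 0 < c₂ ∧ c₂ < c₁ ∧ ∀ θ ∈ Θ, c₂ ≤ q θ ∧ q θ ≤ c₁
  nonempty : Θ.Nonempty
  isCompact : IsCompact Θ
  convex : Convex ℝ Θ

end BayesCredible

end

/-!
The posterior concentrates because the average log-likelihood converges to the expected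
log-likelihood `φ` *uniformly* on `Θ`, almost surely. By domination and continuity, `ln p(ξⁱ|·)` is
an integrable random element of the separable Banach space `C(Θ, ℝ)`, so the uniform convergence is
the strong law of large numbers in that space (`exists_uniform_strong_law`), whose limit `φ` is
automatically continuous on `Θ`.

Once the uniform error is at most `ε`, the likelihood is at most `exp(N(φ(θc) - ω + ε))` off `U_ω`
and at least `exp(N(φ(θc) - b - ε))` on `U_b`. The set `U_b` has positive volume: it is relatively
open in a convex set whose volume is positive, as it carries a probability density. Integrating the
second bound over `U_b` bounds the normalizing constant from below, so the posterior probability of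
leaving `U_ω` is at most `(c₁ / c₂) κ(b)⁻¹ ν exp(-N(ω - b - 2ε))` (`posteriorLaw_real_compl_le`).
With `ε = (ω - a) / 4` the surplus factor `exp(-N(ω - a) / 2)` eventually beats `c₁ / c₂`
(`eventually_posteriorLaw_compl_nbhdU_le`). Conditioning on an event of probability at least `1 - α`
costs at most the factor `(1 - α)⁻¹`.
-/

namespace BayesCredible

/-! ### A uniform strong law of large numbers -/

/-- A map into `C(K, ℝ)` is Borel measurable as soon as all its evaluations are: `C(K, ℝ)` is
separable, so its open sets are countable unions of closed balls, and membership in a closed ball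
can be tested on a countable dense subset of `K`. -/
theorem measurable_of_measurable_eval {K S : Type*} [TopologicalSpace K] [CompactSpace K]
    [R1Space K] [SecondCountableTopology K] [MeasurableSpace S]
    [MeasurableSpace C(K, ℝ)] [BorelSpace C(K, ℝ)] {F : S → C(K, ℝ)}
    (hF : ∀ t, Measurable fun x => F x t) : Measurable F := by
  have hball : ∀ (g : C(K, ℝ)) (r : ℝ), 0 ≤ r →
      MeasurableSet (F ⁻¹' Metric.closedBall g r) := by
    intro g r hr
    obtain ⟨D, hDc, hDd⟩ := TopologicalSpace.exists_countable_dense K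
    have : F ⁻¹' Metric.closedBall g r = ⋂ t ∈ D, {x | dist (F x t) (g t) ≤ r} := by
      ext x
      simp only [Set.mem_preimage, Metric.mem_closedBall, Set.mem_iInter, Set.mem_ofPred_eq]
      rw [ContinuousMap.dist_le hr]
      refine ⟨fun h t _ => h t, fun h t => ?_⟩
      have hcl : IsClosed {t | dist (F x t) (g t) ≤ r} :=
        isClosed_le (by fun_prop) continuous_const
      exact hcl.closure_subset_iff.2 h (hDd t)
    rw [this]
    exact MeasurableSet.biInter hDc fun t _ =>
      measurableSet_le ((hF t).dist measurable_const) measurable_const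
  refine measurable_of_isOpen fun V hV => ?_
  have hr : ∀ g ∈ V, ∃ r > 0, Metric.closedBall g r ⊆ V := fun g hg =>
    Metric.nhds_basis_closedBall.mem_iff.1 (hV.mem_nhds hg)
  choose! r hr0 hrV using hr
  obtain ⟨T, hTV, hTc, hT⟩ := TopologicalSpace.countable_cover_nhdsWithin
    (f := fun g => Metric.closedBall g (r g))
    (fun g hg => mem_nhdsWithin_of_mem_nhds (Metric.closedBall_mem_nhds g (hr0 g hg)))
  have hVeq : V = ⋃ g ∈ T, Metric.closedBall g (r g) :=
    hT.antisymm (Set.iUnion₂_subset fun g hg => hrV g (hTV hg))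
  rw [hVeq, Set.preimage_iUnion₂]
  exact MeasurableSet.biUnion hTc fun g hg => hball g _ (hr0 g (hTV hg)).le

/-- Uniform strong law of large numbers: for a dominated family `g x t`, continuous in `t` over a
compact space, the empirical means converge to the expectation uniformly in `t`. It is the strong
law for the `C(K, ℝ)`-valued random variables `g (ξ i)`, which also makes the expectation a
continuous function of `t`. -/
theorem exists_uniform_strong_law {K S Ω : Type*} [TopologicalSpace K] [Nonempty K]
    [CompactSpace K] [R1Space K] [SecondCountableTopology K] [MeasurableSpace S] {ν : Measure S}
    [MeasurableSpace Ω] {P : Measure Ω} {ξ : ℕ → Ω → S}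
    (hlaw : ∀ i, HasLaw (ξ i) ν P) (hindep : iIndepFun ξ P)
    {g : S → K → ℝ} (hg : ∀ t, Measurable fun x => g x t)
    (hcont : ∀ᵐ x ∂ν, Continuous (g x))
    {h : S → ℝ} (hint : Integrable h ν) (hdom : ∀ᵐ x ∂ν, ∀ t, |g x t| ≤ h x) :
    ∃ Φ : C(K, ℝ), (∀ t, Φ t = ∫ x, g x t ∂ν) ∧
      ∀ᵐ s ∂P, ∀ ε > 0, ∀ᶠ N : ℕ in atTop, ∀ t,
        |∑ i : Fin N, g (ξ i s) t - N * Φ t| ≤ N * ε := by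
  classical
  borelize C(K, ℝ)
  obtain ⟨G, hG, hGm, hGc⟩ := hcont.exists_measurable_mem
  let F : S → C(K, ℝ) := fun x => if hx : x ∈ G then ⟨g x, hGc x hx⟩ else 0
  have hFg : ∀ x ∈ G, ∀ t, F x t = g x t := fun x hx t => by simp [F, hx]
  have hFm : Measurable F := by
    refine measurable_of_measurable_eval fun t => ?_
    have : (fun x => F x t) = G.indicator fun x => g x t := by
      ext x
      by_cases hx : x ∈ G <;> simp [F, hx]
    rw [this]
    exact (hg t).indicator hGm
  have hFint : Integrable F ν := by
    refine hint.mono' hFm.aestronglyMeasurable ?_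
    filter_upwards [hG, hdom] with x hx hd
    refine (ContinuousMap.norm_le_of_nonempty _).2 fun t => ?_
    rw [hFg x hx, Real.norm_eq_abs]
    exact hd t
  have hX : ∀ i, HasLaw (fun s => F (ξ i s)) (ν.map F) P := fun i =>
    HasLaw.fun_comp ⟨hFm.aemeasurable, rfl⟩ (hlaw i)
  have hmean : ∫ s, F (ξ 0 s) ∂P = ∫ x, F x ∂ν := by
    rw [← (hlaw 0).map_eq, integral_map (hlaw 0).aemeasurable hFm.aestronglyMeasurable]
  have hXint : Integrable (fun s => F (ξ 0 s)) P := by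
    have := hFint
    rw [← (hlaw 0).map_eq] at this
    exact this.comp_aemeasurable (hlaw 0).aemeasurable
  have hslln := strong_law_ae (fun i s => F (ξ i s)) hXint
    (fun i j hij => (hindep.indepFun hij).comp hFm hFm)
    (fun i => ⟨(hX i).aemeasurable, (hX 0).aemeasurable, by rw [(hX i).map_eq, (hX 0).map_eq]⟩)
  rw [hmean] at hslln
  refine ⟨∫ x, F x ∂ν, fun t => ?_, ?_⟩
  · rw [ContinuousMap.integral_apply hFint]
    refine integral_congr_ae ?_
    filter_upwards [hG] with x hx using hFg x hx t
  · have hmem : ∀ᵐ s ∂P, ∀ i, ξ i s ∈ G := ae_all_iff.2 fun i =>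
      ae_of_ae_map (hlaw i).aemeasurable (by rw [(hlaw i).map_eq]; exact hG)
    filter_upwards [hslln, hmem] with s hs hsG ε hε
    filter_upwards [(Metric.tendsto_nhds.1 hs) ε hε, eventually_gt_atTop 0] with N hN hN0 t
    have hN' : (0 : ℝ) < N := Nat.cast_pos.2 hN0
    have h1 := (ContinuousMap.dist_apply_le_dist t).trans hN.le
    rw [Real.dist_eq, ContinuousMap.smul_apply, ContinuousMap.sum_apply, smul_eq_mul,
      Finset.sum_range] at h1
    simp only [hFg _ (hsG _)] at h1
    calc |∑ i : Fin N, g (ξ i s) t - N * (∫ x, F x ∂ν : C(K, ℝ)) t|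
        = N * |(N : ℝ)⁻¹ * ∑ i : Fin N, g (ξ i s) t - (∫ x, F x ∂ν : C(K, ℝ)) t| := by
          nth_rw 2 [← abs_of_pos hN']
          rw [← abs_mul, mul_sub, mul_inv_cancel_left₀ hN'.ne']
      _ ≤ N * ε := by gcongr

end BayesCredible

namespace BayesCredible

/-! ### Relatively open subsets of a convex set -/

/-- A convex set of positive volume is contained in the closure of its interior, so an open set
that meets it also meets its interior. -/
theorem measure_inter_pos_of_isOpen {E : Type*} [NormedAddCommGroup E] [NormedSpace ℝ E]
    [MeasurableSpace E] [BorelSpace E] [FiniteDimensional ℝ E] (ν : Measure E)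
    [ν.IsAddHaarMeasure] {s O : Set E} (hs : Convex ℝ s) (hν : ν s ≠ 0)
    (hO : IsOpen O) (hne : (s ∩ O).Nonempty) : 0 < ν (s ∩ O) := by
  have hint : (interior s).Nonempty := by
    by_contra hempty
    rw [Set.not_nonempty_iff_eq_empty] at hempty
    refine hν (measure_mono_null ?_ (hs.addHaar_frontier ν))
    rw [frontier, hempty, Set.sdiff_empty]
    exact subset_closure
  obtain ⟨x, hxs, hxO⟩ := hne
  have hx : x ∈ closure (interior s) := by
    rw [hs.closure_interior_eq_closure_of_nonempty_interior hint]
    exact subset_closure hxs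
  obtain ⟨y, hyO, hys⟩ := mem_closure_iff.1 hx O hO hxO
  exact ((isOpen_interior.inter hO).measure_pos ν ⟨y, hys, hyO⟩).trans_le
    (measure_mono (Set.inter_subset_inter_left _ interior_subset))

/-! ### Bounds for posterior and conditional probabilities -/

/-- Conditioning on an event of probability at least `γ` inflates the probability of a complement
by at most the factor `γ⁻¹`. -/
theorem one_sub_div_le_cond_real {X : Type*} [MeasurableSpace X] (ρ : Measure X)
    [IsFiniteMeasure ρ] {A U : Set X} (hA : MeasurableSet A) (hU : MeasurableSet U) {γ r : ℝ}
    (hγ : 0 < γ) (hcov : ENNReal.ofReal γ ≤ ρ A) (hr : ρ.real Uᶜ ≤ r) :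
    1 - r / γ ≤ (ProbabilityTheory.cond ρ A).real U := by
  have hA0 : ρ A ≠ 0 := ((ENNReal.ofReal_pos.2 hγ).trans_le hcov).ne'
  have := cond_isProbabilityMeasure (μ := ρ) hA0
  have hγA : γ ≤ ρ.real A := (ENNReal.ofReal_le_iff_le_toReal (measure_ne_top ρ A)).1 hcov
  have hcompl : (ProbabilityTheory.cond ρ A).real Uᶜ ≤ r / γ := by
    rw [measureReal_def, cond_apply hA, ENNReal.toReal_mul, ENNReal.toReal_inv, ← measureReal_def,
      ← measureReal_def, inv_mul_eq_div]
    exact div_le_div₀ (measureReal_nonneg.trans hr)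
      ((measureReal_mono Set.inter_subset_right).trans hr) hγ hγA
  rw [probReal_compl_eq_one_sub hU] at hcompl
  linarith

variable {d n : ℕ} {Θ : Set (EuclideanSpace ℝ (Fin n))}
  {p : EuclideanSpace ℝ (Fin d) → EuclideanSpace ℝ (Fin n) → ℝ} {q : EuclideanSpace ℝ (Fin n) → ℝ}
  {N : ℕ} {x : Fin N → EuclideanSpace ℝ (Fin d)}

theorem integrableOn_likelihood_mul (hΘ : IsCompact Θ) (hq : IntegrableOn q Θ volume)
    (hx : ∀ i, ContinuousOn (fun θ => p (x i) θ) Θ) :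
    IntegrableOn (fun θ => likelihood p x θ * q θ) Θ volume :=
  hq.continuousOn_mul (continuousOn_finsetProd _ fun i _ => hx i) hΘ

theorem isFiniteMeasure_posteriorLaw (hΘ : IsCompact Θ) (hq : IntegrableOn q Θ volume)
    (hx : ∀ i, ContinuousOn (fun θ => p (x i) θ) Θ) :
    IsFiniteMeasure (posteriorLaw Θ p q x) :=
  isFiniteMeasure_withDensity_ofReal
    ((integrableOn_likelihood_mul hΘ hq hx).div_const _).hasFiniteIntegral

/-- If the likelihood is at least `l` on a set `V` of positive volume, which bounds the normalizing
integral from below, and at most `m` off `U`, then the posterior probability of leaving `U` is at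
most a multiple of `m / l`. -/
theorem posteriorLaw_real_compl_le (hΘ : IsCompact Θ) (hq : IntegrableOn q Θ volume)
    (hx : ∀ i, ContinuousOn (fun θ => p (x i) θ) Θ)
    (hL0 : ∀ θ ∈ Θ, 0 ≤ likelihood p x θ) {c₁ c₂ : ℝ} (hc₂ : 0 < c₂)
    (hqc : ∀ θ ∈ Θ, c₂ ≤ q θ ∧ q θ ≤ c₁) {U V : Set (EuclideanSpace ℝ (Fin n))}
    (hU : MeasurableSet U) (hV : MeasurableSet V) (hVΘ : V ⊆ Θ) (hV0 : 0 < volume.real V)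
    {l m : ℝ} (hl : 0 < l) (hm : 0 ≤ m) (hlV : ∀ θ ∈ V, l ≤ likelihood p x θ)
    (hmU : ∀ θ ∈ Θ, θ ∉ U → likelihood p x θ ≤ m) :
    (posteriorLaw Θ p q x).real Uᶜ ≤ m * c₁ / (l * c₂ * volume.real V) * volume.real Θ := by
  have hΘtop : volume Θ ≠ ⊤ := hΘ.measure_lt_top.ne
  have hi := integrableOn_likelihood_mul hΘ hq hx
  obtain ⟨v, hv⟩ : V.Nonempty := by
    by_contra h
    simp [Set.not_nonempty_iff_eq_empty.1 h] at hV0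
  have hc₁ : 0 ≤ c₁ := hc₂.le.trans ((hqc v (hVΘ hv)).1.trans (hqc v (hVΘ hv)).2)
  have hZ : l * c₂ * volume.real V ≤ ∫ θ in Θ, likelihood p x θ * q θ := by
    calc l * c₂ * volume.real V = ∫ _ in V, l * c₂ := by
          rw [setIntegral_const, smul_eq_mul, mul_comm]
      _ ≤ ∫ θ in V, likelihood p x θ * q θ := by
          refine setIntegral_mono_on
            (integrableOn_const (measure_ne_top_of_subset hVΘ hΘtop)) (hi.mono_set hVΘ) hV
            fun θ hθ => ?_
          exact mul_le_mul (hlV θ hθ) (hqc θ (hVΘ hθ)).1 hc₂.le (hL0 θ (hVΘ hθ))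
      _ ≤ ∫ θ in Θ, likelihood p x θ * q θ := by
          refine setIntegral_mono_set hi ?_ hVΘ.eventuallyLE
          filter_upwards [ae_restrict_mem hΘ.measurableSet] with θ hθ
          exact mul_nonneg (hL0 θ hθ) (hc₂.le.trans (hqc θ hθ).1)
  have hB : 0 < l * c₂ * volume.real V := by positivity
  set B := m * c₁ / (l * c₂ * volume.real V)
  have hB0 : 0 ≤ B := by positivity
  have hle : posteriorLaw Θ p q x Uᶜ ≤ ENNReal.ofReal B * volume Θ := by
    rw [posteriorLaw, withDensity_apply _ hU.compl, Measure.restrict_restrict hU.compl]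
    calc ∫⁻ θ in Uᶜ ∩ Θ, ENNReal.ofReal (posteriorDensity Θ p q x θ)
        ≤ ∫⁻ _ in Uᶜ ∩ Θ, ENNReal.ofReal B := by
          refine setLIntegral_mono' (hU.compl.inter hΘ.measurableSet) fun θ hθ => ?_
          refine ENNReal.ofReal_le_ofReal (div_le_div₀ (by positivity) ?_ hB hZ)
          exact mul_le_mul (hmU θ hθ.2 hθ.1) (hqc θ hθ.2).2
            (hc₂.le.trans (hqc θ hθ.2).1) hm
      _ ≤ ENNReal.ofReal B * volume Θ := by
          rw [setLIntegral_const]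
          gcongr
          exact Set.inter_subset_right
  calc (posteriorLaw Θ p q x).real Uᶜ ≤ (ENNReal.ofReal B * volume Θ).toReal :=
        ENNReal.toReal_mono (ENNReal.mul_ne_top ENNReal.ofReal_ne_top hΘtop) hle
    _ = B * volume.real Θ := by rw [ENNReal.toReal_mul, ENNReal.toReal_ofReal hB0, measureReal_def]

theorem likelihood_eq_exp_sum_log {θ : EuclideanSpace ℝ (Fin n)} (hpos : ∀ i, 0 < p (x i) θ) :
    likelihood p x θ = Real.exp (∑ i, Real.log (p (x i) θ)) := by
  rw [Real.exp_sum]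
  exact Finset.prod_congr rfl fun i _ => (Real.exp_log (hpos i)).symm

end BayesCredible

namespace BayesCredible

/-! ### Concentration of the posterior distribution -/

variable {d n : ℕ} {μ : Measure (EuclideanSpace ℝ (Fin d))} {Θ : Set (EuclideanSpace ℝ (Fin n))}
  {p : EuclideanSpace ℝ (Fin d) → EuclideanSpace ℝ (Fin n) → ℝ} {q : EuclideanSpace ℝ (Fin n) → ℝ}
  {θc : EuclideanSpace ℝ (Fin n)}

/-- Uniform convergence over `Θ` of the normalized log-likelihood to the expected log-likelihood,
which is continuous on `Θ`. -/
theorem continuousOn_expectedLogLik_and_uniform_convergence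
    (hp : IsDensityFamily μ Θ p) (hreg : Regular μ Θ p q θc)
    {Ω : Type*} [MeasurableSpace Ω] {Pr : Measure Ω}
    {ξ : ℕ → Ω → EuclideanSpace ℝ (Fin d)}
    (hlaw : ∀ i, HasLaw (ξ i) (samplingLaw μ p θc) Pr) (hindep : iIndepFun ξ Pr) :
    ContinuousOn (expectedLogLik μ p θc) Θ ∧
      ∀ᵐ s ∂Pr, ∀ ε > 0, ∀ᶠ N : ℕ in atTop, ∀ θ ∈ Θ,
        |∑ i : Fin N, Real.log (p (ξ i s) θ) - N * expectedLogLik μ p θc θ| ≤ N * ε := by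
  have : CompactSpace Θ := isCompact_iff_compactSpace.1 hreg.isCompact
  have : Nonempty Θ := hreg.nonempty.to_subtype
  obtain ⟨h, hint, hdom⟩ := hreg.dominated
  have hcont : ∀ᵐ x ∂(samplingLaw μ p θc), Continuous fun θ : Θ => Real.log (p x θ) := by
    filter_upwards [hdom, hreg.continuousOn] with x hx hc
    exact (continuousOn_iff_continuous_domRestrict.1 hc).log fun θ => (hx θ θ.2).1.ne'
  obtain ⟨Φ, hΦ, hlim⟩ := exists_uniform_strong_law hlaw hindep
    (g := fun x (θ : Θ) => Real.log (p x θ))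
    (fun θ => (hp.measurable θ θ.2).log) hcont hint (hdom.mono fun x hx θ => (hx θ θ.2).2)
  refine ⟨continuousOn_iff_continuous_domRestrict.2 ?_, ?_⟩
  · exact Φ.continuous.congr hΦ
  · filter_upwards [hlim] with s hs ε hε
    filter_upwards [hs ε hε] with N hN θ hθ
    have := hN ⟨θ, hθ⟩
    rwa [hΦ] at this

theorem exists_isOpen_nbhdU_eq (hφ : ContinuousOn (expectedLogLik μ p θc) Θ) (b : ℝ) :
    ∃ O, IsOpen O ∧ nbhdU μ Θ p θc b = Θ ∩ O := by
  obtain ⟨O, hO, hOeq⟩ := (continuousOn_iff'.1 hφ) _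
    (isOpen_Ioi (a := expectedLogLik μ p θc θc - b))
  refine ⟨O, hO, ?_⟩
  rw [Set.inter_comm, ← hOeq]
  ext θ
  simp only [nbhdU, Set.mem_inter_iff, Set.mem_preimage, Set.mem_Ioi, Set.mem_ofPred_eq]
  rw [and_comm, sub_lt_comm]

/-- The posterior probability of leaving `U_ω` decays exponentially, at any rate below `ω - b`. The
ratio `c₁ / c₂` of the prior bounds and the error of the uniform law of large numbers are both
absorbed by the slack between `a` and `ω`. -/
theorem eventually_posteriorLaw_compl_nbhdU_le (hreg : Regular μ Θ p q θc)
    (hq : IntegrableOn q Θ volume) (hφ : ContinuousOn (expectedLogLik μ p θc) Θ)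
    {x : ℕ → EuclideanSpace ℝ (Fin d)} (hx : ∀ i, ContinuousOn (fun θ => p (x i) θ) Θ)
    (hpos : ∀ i, ∀ θ ∈ Θ, 0 < p (x i) θ)
    (hlim : ∀ ε > 0, ∀ᶠ N : ℕ in atTop, ∀ θ ∈ Θ,
      |∑ i : Fin N, Real.log (p (x i) θ) - N * expectedLogLik μ p θc θ| ≤ N * ε)
    {a b ω : ℝ} (haω : a < ω) (hb : 0 < volume.real (nbhdU μ Θ p θc b)) :
    ∀ᶠ N : ℕ in atTop, (posteriorLaw Θ p q fun i : Fin N => x i).real (nbhdU μ Θ p θc ω)ᶜ ≤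
      (volume.real (nbhdU μ Θ p θc b))⁻¹ * volume.real Θ * Real.exp (-(N * (a - b))) := by
  obtain ⟨c₁, c₂, hc₂, hc, hqc⟩ := hreg.prior_bounds
  have hmeas : ∀ r, MeasurableSet (nbhdU μ Θ p θc r) := fun r => by
    obtain ⟨O, hO, hOeq⟩ := exists_isOpen_nbhdU_eq hφ r
    exact hOeq ▸ hreg.isCompact.measurableSet.inter hO.measurableSet
  have hdecay : Tendsto (fun N : ℕ => Real.exp (-(N * ((ω - a) / 2))) * c₁) atTop (𝓝 0) := by
    have h1 : Tendsto (fun N : ℕ => (N : ℝ) * ((ω - a) / 2)) atTop atTop :=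
      tendsto_natCast_atTop_atTop.atTop_mul_const (by linarith)
    simpa using (Real.tendsto_exp_neg_atTop_nhds_zero.comp h1).mul_const c₁
  filter_upwards [hlim ((ω - a) / 4) (by linarith), hdecay.eventually_le_const hc₂] with N hN hNc
  set φ := expectedLogLik μ p θc
  set κ := volume.real (nbhdU μ Θ p θc b)
  have hN0 : (0 : ℝ) ≤ N := N.cast_nonneg
  have hexp : ∀ θ ∈ Θ, likelihood p (fun i : Fin N => x i) θ
      = Real.exp (∑ i : Fin N, Real.log (p (x i) θ)) := fun θ hθ =>
    likelihood_eq_exp_sum_log fun i => hpos i θ hθ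
  have hbound := posteriorLaw_real_compl_le hreg.isCompact hq (x := fun i : Fin N => x i)
    (fun i => hx i) (fun θ hθ => by rw [hexp θ hθ]; exact (Real.exp_pos _).le) hc₂ hqc
    (hmeas ω) (hmeas b) (fun θ hθ => hθ.1) hb
    (l := Real.exp (N * (φ θc - b) - N * ((ω - a) / 4)))
    (m := Real.exp (N * (φ θc - ω) + N * ((ω - a) / 4))) (Real.exp_pos _) (Real.exp_pos _).le
    (fun θ hθ => by
      rw [hexp θ hθ.1, Real.exp_le_exp]
      have h1 := (abs_le.1 (hN θ hθ.1)).1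
      have h2 : (N : ℝ) * (φ θc - b) ≤ N * φ θ :=
        mul_le_mul_of_nonneg_left (by linarith [hθ.2]) hN0
      linarith)
    (fun θ hθ hθU => by
      rw [hexp θ hθ, Real.exp_le_exp]
      have h1 := (abs_le.1 (hN θ hθ)).2
      have h3 : ω ≤ φ θc - φ θ := not_lt.1 fun h => hθU ⟨hθ, h⟩
      have h2 : (N : ℝ) * φ θ ≤ N * (φ θc - ω) :=
        mul_le_mul_of_nonneg_left (by linarith) hN0
      linarith)
  refine hbound.trans ?_
  have hsplit : Real.exp (N * (φ θc - ω) + N * ((ω - a) / 4))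
      = Real.exp (N * (φ θc - b) - N * ((ω - a) / 4)) * Real.exp (-(N * (a - b)))
        * Real.exp (-(N * ((ω - a) / 2))) := by
    rw [← Real.exp_add, ← Real.exp_add]
    congr 1
    ring
  rw [hsplit]
  set l := Real.exp (N * (φ θc - b) - N * ((ω - a) / 4))
  have hl : 0 < l := Real.exp_pos _
  calc l * Real.exp (-(N * (a - b))) * Real.exp (-(N * ((ω - a) / 2))) * c₁ / (l * c₂ * κ)
        * volume.real Θ
      = κ⁻¹ * volume.real Θ * Real.exp (-(N * (a - b)))
        * (Real.exp (-(N * ((ω - a) / 2))) * c₁ / c₂) := by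
        field_simp
    _ ≤ κ⁻¹ * volume.real Θ * Real.exp (-(N * (a - b))) * 1 := by
        gcongr
        exact (div_le_one hc₂).2 hNc
    _ = _ := mul_one _

end BayesCredible

theorem theorem6 {d n : ℕ}
    (μ : Measure (EuclideanSpace ℝ (Fin d)))
    (Θ : Set (EuclideanSpace ℝ (Fin n)))
    (p : EuclideanSpace ℝ (Fin d) → EuclideanSpace ℝ (Fin n) → ℝ)
    (q : EuclideanSpace ℝ (Fin n) → ℝ)
    (θc : EuclideanSpace ℝ (Fin n)) (hθc : θc ∈ Θ)
    (hp : BayesCredible.IsDensityFamily μ Θ p)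
    (hq : BayesCredible.IsPriorDensity Θ q)
    (hreg : BayesCredible.Regular μ Θ p q θc)
    -- an i.i.d. sequence of observations with law `P_θc`
    {Ω : Type*} [MeasurableSpace Ω] (Pr : Measure Ω) [IsProbabilityMeasure Pr]
    (ξ : ℕ → Ω → EuclideanSpace ℝ (Fin d))
    (hlaw : ∀ i, HasLaw (ξ i) (BayesCredible.samplingLaw μ p θc) Pr)
    (hindep : iIndepFun ξ Pr)
    -- the credible sets `Θ(S^N, α)`, as functions of the sample
    (α : ℝ) (hα0 : 0 ≤ α) (hα1 : α < 1)
    (C : (N : ℕ) → (Fin N → EuclideanSpace ℝ (Fin d)) → Set (EuclideanSpace ℝ (Fin n)))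
    (hC : ∀ᵐ s ∂Pr, ∀ N : ℕ, BayesCredible.IsCredibleSet Θ
      (BayesCredible.posteriorLaw Θ p q fun i : Fin N => ξ i s) α (C N fun i => ξ i s))
    (ω : ℝ) (hω : 0 < ω) :
    (∀ᵐ s ∂Pr, Tendsto (fun N : ℕ =>
        (ProbabilityTheory.cond (BayesCredible.posteriorLaw Θ p q fun i : Fin N => ξ i s)
          (C N fun i => ξ i s)).real (BayesCredible.nbhdU μ Θ p θc ω))
      atTop (𝓝 1)) ∧
    ∀ a b : ℝ, 0 < b → b < a → a < ω →
      0 < volume.real (BayesCredible.nbhdU μ Θ p θc b) ∧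
      ∀ᵐ s ∂Pr, ∀ᶠ N : ℕ in atTop,
        1 - (volume.real (BayesCredible.nbhdU μ Θ p θc b))⁻¹ * volume.real Θ *
            Real.exp (-(N * (a - b))) / (1 - α) ≤
          (ProbabilityTheory.cond (BayesCredible.posteriorLaw Θ p q fun i : Fin N => ξ i s)
            (C N fun i => ξ i s)).real (BayesCredible.nbhdU μ Θ p θc ω) := by
  obtain ⟨hφ, hlim⟩ :=
    BayesCredible.continuousOn_expectedLogLik_and_uniform_convergence hp hreg hlaw hindep
  have hvol : volume Θ ≠ 0 := fun h0 => by
    have := hq.integral_eq_one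
    rw [Measure.restrict_eq_zero.2 h0, integral_zero_measure] at this
    exact zero_ne_one this
  have hκ : ∀ b > 0, 0 < volume.real (BayesCredible.nbhdU μ Θ p θc b) := by
    intro b hb
    obtain ⟨O, hO, hOeq⟩ := BayesCredible.exists_isOpen_nbhdU_eq hφ b
    have hmem : θc ∈ BayesCredible.nbhdU μ Θ p θc b := ⟨hθc, by rwa [sub_self]⟩
    rw [hOeq] at hmem ⊢
    exact ENNReal.toReal_pos
      (BayesCredible.measure_inter_pos_of_isOpen volume hreg.convex hvol hO ⟨θc, hmem⟩).ne'
      (measure_ne_top_of_subset Set.inter_subset_left hreg.isCompact.measure_lt_top.ne)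
  have hU : MeasurableSet (BayesCredible.nbhdU μ Θ p θc ω) := by
    obtain ⟨O, hO, hOeq⟩ := BayesCredible.exists_isOpen_nbhdU_eq hφ ω
    exact hOeq ▸ hreg.isCompact.measurableSet.inter hO.measurableSet
  obtain ⟨h, -, hdom⟩ := hreg.dominated
  have hgood : ∀ᵐ s ∂Pr, ∀ i, (∀ θ ∈ Θ, 0 < p (ξ i s) θ) ∧
      ContinuousOn (fun θ => p (ξ i s) θ) Θ := by
    refine ae_all_iff.2 fun i => ae_of_ae_map (hlaw i).aemeasurable ?_
      (p := fun x => (∀ θ ∈ Θ, 0 < p x θ) ∧ ContinuousOn (fun θ => p x θ) Θ)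
    rw [(hlaw i).map_eq]
    filter_upwards [hdom, hreg.continuousOn] with x hx hc using ⟨fun θ hθ => (hx θ hθ).1, hc⟩
  have hα : 0 < 1 - α := by linarith
  have hfin : ∀ s, (∀ i, (∀ θ ∈ Θ, 0 < p (ξ i s) θ) ∧ ContinuousOn (fun θ => p (ξ i s) θ) Θ) →
      ∀ N : ℕ, IsFiniteMeasure (BayesCredible.posteriorLaw Θ p q fun i : Fin N => ξ i s) :=
    fun s hs N => BayesCredible.isFiniteMeasure_posteriorLaw hreg.isCompact hq.integrableOn
      fun i => (hs i).2
  have hrate : ∀ a b : ℝ, 0 < b → b < a → a < ω → ∀ᵐ s ∂Pr, ∀ᶠ N : ℕ in atTop,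
      1 - (volume.real (BayesCredible.nbhdU μ Θ p θc b))⁻¹ * volume.real Θ *
          Real.exp (-(N * (a - b))) / (1 - α) ≤
        (ProbabilityTheory.cond (BayesCredible.posteriorLaw Θ p q fun i : Fin N => ξ i s)
          (C N fun i => ξ i s)).real (BayesCredible.nbhdU μ Θ p θc ω) := by
    intro a b hb _ haω
    filter_upwards [hlim, hgood, hC] with s hs hsg hsC
    filter_upwards [BayesCredible.eventually_posteriorLaw_compl_nbhdU_le hreg hq.integrableOn hφ
      (fun i => (hsg i).2) (fun i => (hsg i).1) hs haω (hκ b hb)] with N hN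
    have := hfin s hsg N
    exact BayesCredible.one_sub_div_le_cond_real _ (hsC N).measurableSet hU hα
      (hsC N).coverage hN
  refine ⟨?_, fun a b hb hba haω => ⟨hκ b hb, hrate a b hb hba haω⟩⟩
  -- the limit follows from the rate for any admissible pair, e.g. `b = ω / 3` and `a = ω / 2`
  filter_upwards [hrate (ω / 2) (ω / 3) (by linarith) (by linarith) (by linarith)] with s hs
  refine tendsto_of_tendsto_of_tendsto_of_le_of_le' ?_ tendsto_const_nhds hs
    (Eventually.of_forall fun N => measureReal_le_one)
  have h1 : Tendsto (fun N : ℕ => (N : ℝ) * (ω / 2 - ω / 3)) atTop atTop :=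
    tendsto_natCast_atTop_atTop.atTop_mul_const (by linarith)
  simpa using (((Real.tendsto_exp_neg_atTop_nhds_zero.comp h1).const_mul
    ((volume.real (BayesCredible.nbhdU μ Θ p θc (ω / 3)))⁻¹ * volume.real Θ)).div_const
    (1 - α)).const_sub 1
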